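/- Let $n,t\in\mathbb N$, let $G$ be an infinite (commutative, unital) integral domain, and let $P\colon G^n\to G^t$ be a polynomial mapping over $G$, that is, $P=(p_1,\dots,p_t)$ where each $p_i\colon G^n\to G$ is given by a polynomial in $n$ variables with coefficients in $G$. Suppose that $P(0)=0$, and let $F\subset G^n$ be a finite set such that $P$ is one-to-one on $F$. Then for every $r\in\mathbb N$ and every coloring $\chi\colon G^t\to\{1,\dots,r\}$ there are $h\in G^t$ and $x\in G$ such that the set $$h+P(xF)=\{\,h+P(xv) : v\in F\,\}$$ is monochromatic (that is, $\chi$ takes a single value on it) and has the same cardinality as $F$. Here $xv=(xv_1,\dots,xv_n)$ for $v=(v_1,\dots,v_n)\in G^n$, and the empty set counts as monochromatic. -/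

import Mathlib

/-- A map `P : Gⁿ → Gᵗ` is a polynomial mapping over the commutative ring `G` if each of its `t`
components is the evaluation of a polynomial in `n` variables with coefficients in `G`. -/
def IsPolynomialMapping {G : Type*} [CommRing G] {n t : ℕ}
    (P : (Fin n → G) → (Fin t → G)) : Prop :=
  ∃ p : Fin t → MvPolynomial (Fin n) G, ∀ v i, P v i = MvPolynomial.eval v (p i)

/-- A set `A` is monochromatic for the `r`-coloring `χ` if `χ` takes a single value on `A`. -/
def IsMonochromatic {W : Type*} {r : ℕ} (χ : W → Fin r) (A : Set W) : Prop :=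
  ∃ c : Fin r, ∀ a ∈ A, χ a = c

/-! On the line through `v`, `P` becomes a one-variable polynomial over the product ring `G^t`, with
`x` read as a constant tuple. The constant tuples form an additive subgroup, infinite when `t > 0`,
and polynomial van der Waerden along it (`isPartitionRecurrent_of_finite`) yields `h` and `x`, with
`x` outside any prescribed finite set. For distinct `v, w` in `F`, some coordinate of `P(xv) -
P(xw)` is a polynomial in `x` that is nonzero at `x = 1`; avoiding its finitely many roots preserves
the cardinality.

Van der Waerden itself is color focusing (`exists_monochromatic_or_focused`) inside an induction on
degrees. Leading coefficients are only subtracted, never multiplied, so the zero divisors of `G^t`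
do no harm. -/

open Polynomial in
/-- The increment `q(X + y) - q(y)` of the polynomial `q` from the point `y`. -/
noncomputable def polyIncrement {R : Type*} [CommRing R] (y : R) (q : R[X]) : R[X] :=
  taylor y q - C (q.eval y)

/-- A set `A` of polynomials over `R` is partition recurrent along `S` if for each number of colors
and each finite set `B` there are finite sets `H` of starting points and `D ⊆ S \ B` of steps
such that every coloring of `R` is constant on `{h} ∪ {h + q(x) : q ∈ A}` for
some `h ∈ H` and `x ∈ D`. -/
def IsPartitionRecurrent {R : Type*} [CommRing R] (S : Set R) (A : Set (Polynomial R)) : Prop :=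
  ∀ B : Set R, B.Finite → ∀ k : ℕ, ∃ H D : Set R, H.Finite ∧ D.Finite ∧ D ⊆ S \ B ∧
    ∀ χ : R → Fin k, ∃ h ∈ H, ∃ x ∈ D, ∀ q ∈ A, χ (h + q.eval x) = χ h

/-! ### Polynomial van der Waerden: color focusing and degree induction. -/

section PolynomialVanDerWaerden

open Polynomial

variable {R : Type*} [CommRing R]

theorem eval_polyIncrement (x y : R) (q : R[X]) :
    (polyIncrement y q).eval x = q.eval (x + y) - q.eval y := by
  simp [polyIncrement, taylor_eval]

theorem natDegree_polyIncrement (y : R) (q : R[X]) :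
    (polyIncrement y q).natDegree = q.natDegree := by
  rw [polyIncrement, natDegree_sub_C, natDegree_taylor]

theorem coeff_polyIncrement_natDegree (y : R) {q : R[X]} (hq : q.natDegree ≠ 0) :
    (polyIncrement y q).coeff q.natDegree = q.leadingCoeff := by
  rw [polyIncrement, coeff_sub, coeff_taylor_natDegree, coeff_C, if_neg hq, sub_zero]

theorem IsPartitionRecurrent.exists_of_finite {S : Set R} {A : Set R[X]}
    (hA : IsPartitionRecurrent S A) {B : Set R} (hB : B.Finite) (κ : Type*) [Finite κ] :
    ∃ H D : Set R, H.Finite ∧ D.Finite ∧ D ⊆ S \ B ∧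
      ∀ χ : R → κ, ∃ h ∈ H, ∃ x ∈ D, ∀ q ∈ A, χ (h + q.eval x) = χ h := by
  obtain ⟨k, ⟨e⟩⟩ := Finite.exists_equiv_fin κ
  obtain ⟨H, D, hH, hD, hDS, hχ⟩ := hA B hB k
  refine ⟨H, D, hH, hD, hDS, fun χ => ?_⟩
  obtain ⟨h, hh, x, hx, hq⟩ := hχ (fun a => e (χ a))
  exact ⟨h, hh, x, hx, fun q hqA => e.injective (hq q hqA)⟩

/-- Color focusing: if all families of differences of increments are partition recurrent, one finds
either a monochromatic configuration or arbitrarily many monochromatic progressions of different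
colors with a common focus `a`. -/
theorem exists_monochromatic_or_focused {S : AddSubgroup R} {A : Set R[X]} (hAfin : A.Finite)
    (hA0 : ∀ q ∈ A, q.eval 0 = 0) (p : R[X])
    (ih : ∀ Y : Set R, Y.Finite → IsPartitionRecurrent (S : Set R)
      (Set.image2 (fun y q => polyIncrement y q - p) Y A))
    {B : Set R} (hB : B.Finite) (k s : ℕ) :
    ∃ H D : Set R, H.Finite ∧ D.Finite ∧ D ⊆ (S : Set R) \ B ∧ ∀ χ : R → Fin k,
      (∃ h ∈ H, ∃ x ∈ D, ∀ q ∈ A, χ (h + q.eval x) = χ h) ∨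
      ∃ a ∈ H, ∃ C : Finset (Fin k), C.card = s ∧
        ∀ c ∈ C, ∃ x ∈ D, ∀ q ∈ A, χ (a + q.eval x) = c := by
  induction s with
  | zero =>
    exact ⟨{0}, ∅, Set.finite_singleton 0, Set.finite_empty, Set.empty_subset _,
      fun χ => Or.inr ⟨0, rfl, ∅, rfl, by simp⟩⟩
  | succ s ihs =>
    obtain ⟨H, D, hH, hD, hDS, hfocus⟩ := ihs
    have hV : (Set.image2 (fun q d => q.eval d) A D).Finite := hAfin.image2 _ hD
    -- All points the old configurations can use. As `W` is finite, coloring `u` by the pattern of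
    -- `χ` on `u + W` is again a finite coloring.
    let W : Set R := H ∪ Set.image2 (· + ·) H (Set.image2 (fun q d => q.eval d) A D)
    have hW : W.Finite := hH.union (hH.image2 _ hV)
    have : Finite W := hW
    -- Avoiding `B - D` as well keeps the combined steps `x + d` out of `B`.
    have hB' : (B ∪ Set.image2 (· - ·) B D).Finite := hB.union (hB.image2 _ hD)
    obtain ⟨H', D', hH', hD', hDS', hrec⟩ :=
      -- The increment at `0` creates a new progression with step `x`; those at `d ∈ D` turn old
      -- steps `d` into `x + d`.
      (ih (insert 0 D) (hD.insert 0)).exists_of_finite hB' (W → Fin k)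
    have hHH : (Set.image2 (· + ·) H' H).Finite := hH'.image2 _ hH
    refine ⟨Set.image2 (· + ·) H' H ∪
        Set.image2 (· - ·) (Set.image2 (· + ·) H' H) ((fun x => p.eval x) '' D'),
      D ∪ (D' ∪ Set.image2 (· + ·) D' D), hHH.union (hHH.image2 _ (hD'.image _)),
      hD.union (hD'.union (hD'.image2 _ hD)), ?_, fun χ => ?_⟩
    · rintro z (hz | hz | ⟨x, hx, d, hd, rfl⟩)
      · exact hDS hz
      · exact ⟨(hDS' hz).1, fun h => (hDS' hz).2 (Or.inl h)⟩
      · exact ⟨S.add_mem (hDS' hx).1 (hDS hd).1,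
          fun h => (hDS' hx).2 (Or.inr ⟨x + d, h, d, hd, add_sub_cancel_right x d⟩)⟩
    obtain ⟨h, hh, x, hx, hblock⟩ := hrec (fun u w => χ (u + w))
    have hshift : ∀ y ∈ insert 0 D, ∀ q ∈ A, ∀ w ∈ W,
        χ (h + (q.eval (x + y) - q.eval y - p.eval x) + w) = χ (h + w) := by
      intro y hy q hq w hw
      have := congrFun (hblock _ ⟨y, hy, q, hq, rfl⟩) ⟨w, hw⟩
      simpa only [eval_sub, eval_polyIncrement] using this
    rcases hfocus (fun u => χ (h + u)) with ⟨a, ha, d, hd, hmono⟩ | ⟨a, ha, C, hC, hprog⟩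
    · refine Or.inl ⟨h + a, Or.inl ⟨h, hh, a, ha, rfl⟩, d, Or.inl hd, fun q hq => ?_⟩
      rw [add_assoc]
      exact hmono q hq
    by_cases hcol : χ (h + a) ∈ C
    · obtain ⟨d, hd, hprog⟩ := hprog _ hcol
      refine Or.inl ⟨h + a, Or.inl ⟨h, hh, a, ha, rfl⟩, d, Or.inl hd, fun q hq => ?_⟩
      rw [add_assoc]
      exact hprog q hq
    -- Seen from this new focus, `q(x + d)` lands on `h + a + q(d)` moved by `q(x + d) - q(d) -
    -- p(x)`, which preserves the color. The new progression has the color of `h + a`.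
    refine Or.inr ⟨h + a - p.eval x, Or.inr ⟨_, ⟨h, hh, a, ha, rfl⟩, _, ⟨x, hx, rfl⟩, rfl⟩,
      Finset.cons _ C hcol, by rw [Finset.card_cons, hC], fun c hc => ?_⟩
    rcases Finset.mem_cons.1 hc with rfl | hc
    · refine ⟨x, Or.inr (Or.inl hx), fun q hq => ?_⟩
      rw [← hshift 0 (Set.mem_insert _ _) q hq a (Or.inl ha), add_zero, hA0 q hq]
      congr 1
      ring
    · obtain ⟨d, hd, hprog⟩ := hprog c hc
      refine ⟨x + d, Or.inr (Or.inr ⟨x, hx, d, hd, rfl⟩), fun q hq => ?_⟩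
      rw [← hprog q hq, ← hshift d (Set.mem_insert_of_mem _ hd) q hq (a + q.eval d)
        (Or.inr ⟨a, ha, _, ⟨q, hq, d, hd, rfl⟩, rfl⟩)]
      congr 1
      ring

/-- Focusing on `k + 1` distinct colors is impossible with only `k`, so the monochromatic
alternative must occur. -/
theorem IsPartitionRecurrent.of_increments {S : AddSubgroup R} {A : Set R[X]} (hAfin : A.Finite)
    (hA0 : ∀ q ∈ A, q.eval 0 = 0) (p : R[X])
    (ih : ∀ Y : Set R, Y.Finite → IsPartitionRecurrent (S : Set R)
      (Set.image2 (fun y q => polyIncrement y q - p) Y A)) :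
    IsPartitionRecurrent (S : Set R) A := by
  intro B hB k
  obtain ⟨H, D, hH, hD, hDS, hχ⟩ :=
    exists_monochromatic_or_focused hAfin hA0 p ih hB k (k + 1)
  refine ⟨H, D, hH, hD, hDS, fun χ => (hχ χ).resolve_right ?_⟩
  rintro ⟨a, -, C, hC, -⟩
  have := C.card_le_univ
  rw [hC, Fintype.card_fin] at this
  omega

theorem natDegree_ne_zero_of_eval_zero {q : R[X]} (hq : q ≠ 0) (hq0 : q.eval 0 = 0) :
    q.natDegree ≠ 0 := by
  intro h
  rw [eq_C_of_natDegree_eq_zero h, eval_C] at hq0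
  exact hq (by rw [eq_C_of_natDegree_eq_zero h, hq0, C_0])

/-- Subtracting a polynomial `p` of degree at most that of `q` from an increment of `q` either
drops the degree below that of `p`, or acts on the pair of degree and leading coefficient
by translation. -/
theorem polyIncrement_sub_cases (y : R) {p q : R[X]} (hp : p ≠ 0)
    (hp0 : p.eval 0 = 0) (hpq : p.natDegree ≤ q.natDegree) :
    polyIncrement y q - p = 0 ∨ (polyIncrement y q - p).natDegree < p.natDegree ∨
      ((q.natDegree, q.leadingCoeff) ≠ (p.natDegree, p.leadingCoeff) ∧
        (polyIncrement y q - p).natDegree = q.natDegree ∧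
        (polyIncrement y q - p).leadingCoeff =
          if q.natDegree = p.natDegree then q.leadingCoeff - p.leadingCoeff
          else q.leadingCoeff) := by
  have hpd := natDegree_ne_zero_of_eval_zero hp hp0
  have hqd : q.natDegree ≠ 0 := by omega
  have hq : q ≠ 0 := by rintro rfl; exact hqd natDegree_zero
  have hle : (polyIncrement y q - p).natDegree ≤ q.natDegree :=
    (natDegree_sub_le _ _).trans (max_le (natDegree_polyIncrement y q).le hpq)
  have hcoeff : (polyIncrement y q - p).coeff q.natDegree =
      if q.natDegree = p.natDegree then q.leadingCoeff - p.leadingCoeff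
      else q.leadingCoeff := by
    rw [coeff_sub, coeff_polyIncrement_natDegree y hqd]
    split_ifs with h
    · rw [h, coeff_natDegree]
    · rw [coeff_eq_zero_of_natDegree_lt (by omega), sub_zero]
  by_cases hcl : (q.natDegree, q.leadingCoeff) = (p.natDegree, p.leadingCoeff)
  · rw [Prod.mk.injEq] at hcl
    rw [if_pos hcl.1, hcl.2, sub_self] at hcoeff
    by_cases hz : polyIncrement y q - p = 0
    · exact Or.inl hz
    refine Or.inr (Or.inl (lt_of_le_of_ne (hcl.1 ▸ hle) fun h => hz ?_))
    rw [← leadingCoeff_eq_zero, leadingCoeff, h, ← hcl.1, hcoeff]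
  · have hne : (polyIncrement y q - p).coeff q.natDegree ≠ 0 := by
      rw [hcoeff]
      split_ifs with h
      · rw [sub_ne_zero]
        exact fun h' => hcl (by rw [h, h'])
      · exact leadingCoeff_ne_zero.2 hq
    have heq := le_antisymm hle (le_natDegree_of_ne_zero hne)
    exact Or.inr (Or.inr ⟨hcl, heq, by rw [leadingCoeff, heq, hcoeff]⟩)

/-- The polynomial van der Waerden theorem along an infinite additive subgroup of a commutative
ring. The multiset `T` contains the pairs of degree and leading coefficient occurring in
`A`; the induction is on its multiset of degrees. -/
theorem isPartitionRecurrent_of_mem {S : AddSubgroup R} (hS : (S : Set R).Infinite)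
    (m : Multiset ℕ) : ∀ (T : Multiset (ℕ × R)), T.map Prod.fst = m →
      ∀ A : Set R[X], A.Finite → (∀ q ∈ A, q.eval 0 = 0) →
        (∀ q ∈ A, q ≠ 0 → (q.natDegree, q.leadingCoeff) ∈ T) →
        IsPartitionRecurrent (S : Set R) A := by
  classical
  induction m using (Multiset.wellFounded_isDershowitzMannaLT (α := ℕ)).induction with
  | _ m ih =>
  rintro T rfl A hAfin hA0 hAT
  by_cases hnz : ∃ q ∈ A, q ≠ 0
  swap
  · push Not at hnz
    intro B hB k
    obtain ⟨x, hx⟩ := (hS.sdiff hB).nonempty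
    refine ⟨{0}, {x}, Set.finite_singleton _, Set.finite_singleton _,
      Set.singleton_subset_iff.2 hx, fun χ => ⟨0, rfl, x, rfl, fun q hq => ?_⟩⟩
    rw [hnz q hq, eval_zero, add_zero]
  -- Zero polynomials are discarded, since the starting point is always part of the configuration.
  suffices hmain : IsPartitionRecurrent (S : Set R) (A \ {0}) by
    intro B hB k
    obtain ⟨H, D, hH, hD, hDS, hχ⟩ := hmain B hB k
    refine ⟨H, D, hH, hD, hDS, fun χ => ?_⟩
    obtain ⟨h, hh, x, hx, hq⟩ := hχ χ
    refine ⟨h, hh, x, hx, fun q hqA => ?_⟩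
    by_cases hq0 : q = 0
    · rw [hq0, eval_zero, add_zero]
    · exact hq q ⟨hqA, hq0⟩
  have hfin' : (A \ {0}).Finite := hAfin.sdiff
  obtain ⟨p, ⟨hpA, hp⟩, hmin⟩ := hfin'.exists_minimalFor natDegree _
    (by obtain ⟨q, hq, hq0⟩ := hnz; exact ⟨q, hq, hq0⟩)
  have hmin' : ∀ q ∈ A \ {0}, p.natDegree ≤ q.natDegree := fun q hq =>
    (le_total p.natDegree q.natDegree).elim id fun h => hmin hq h
  obtain ⟨T₀, rfl⟩ := Multiset.exists_cons_of_mem (hAT p hpA hp)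
  refine IsPartitionRecurrent.of_increments hfin' (fun q hq => hA0 q hq.1) p fun Y hY => ?_
  have hA' := hY.image2 (fun y q => polyIncrement y q - p) hfin'
  -- However many increments `Y` produces, one copy of the degree of `p` is traded for finitely many
  -- smaller degrees; the remaining pairs keep their degrees. This is a descent in the
  -- Dershowitz–Manna order.
  let low : Multiset (ℕ × R) :=
    ((hA'.toFinset.filter fun q => q.natDegree < p.natDegree).val.map
      fun q => (q.natDegree, q.leadingCoeff))
  let shift : ℕ × R → ℕ × R := fun c =>
    (c.1, if c.1 = p.natDegree then c.2 - p.leadingCoeff else c.2)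
  refine ih ((T₀.map shift + low).map Prod.fst) ?_ (T₀.map shift + low) rfl _ hA' ?_ ?_
  · refine ⟨T₀.map Prod.fst, low.map Prod.fst, {p.natDegree}, by simp, ?_, ?_, ?_⟩
    · simp [shift, Multiset.map_map]
    · rw [Multiset.map_cons, add_comm, Multiset.singleton_add]
    · simp only [low, Multiset.mem_map, Multiset.mem_singleton, exists_eq_left]
      rintro _ ⟨_, ⟨q, hq, rfl⟩, rfl⟩
      exact (Finset.mem_filter.1 hq).2
  · rintro _ ⟨y, -, q, -, rfl⟩
    simp [eval_polyIncrement, hA0 p hpA]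
  · rintro u hu hu0
    obtain ⟨y, -, q, hq, rfl⟩ := id hu
    rw [Multiset.mem_add]
    rcases polyIncrement_sub_cases y hp (hA0 p hpA) (hmin' q hq) with h | h | ⟨hne, hd, hl⟩
    · exact absurd h hu0
    · exact Or.inr (Multiset.mem_map.2
        ⟨_, Finset.mem_filter.2 ⟨hA'.mem_toFinset.2 hu, h⟩, rfl⟩)
    · refine Or.inl (Multiset.mem_map.2 ⟨(q.natDegree, q.leadingCoeff),
        (Multiset.mem_cons.1 (hAT q hq.1 hq.2)).resolve_left hne, ?_⟩)
      rw [hd, hl]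

theorem isPartitionRecurrent_of_finite {S : AddSubgroup R} (hS : (S : Set R).Infinite)
    {A : Set R[X]} (hA : A.Finite) (hA0 : ∀ q ∈ A, q.eval 0 = 0) :
    IsPartitionRecurrent (S : Set R) A :=
  isPartitionRecurrent_of_mem hS _
    (hA.toFinset.val.map fun q => (q.natDegree, q.leadingCoeff)) rfl A hA hA0
    fun _ hq _ => Multiset.mem_map.2 ⟨_, hA.mem_toFinset.2 hq, rfl⟩

end PolynomialVanDerWaerden

/-! ### Passage from polynomial mappings to polynomials over the product ring. -/

section PolynomialMapping

open Polynomial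

variable {G : Type*} [CommRing G]

/-- The restriction of a multivariate polynomial to the line through `0` and `v`. -/
noncomputable def lineRestriction {n : ℕ} (v : Fin n → G) (p : MvPolynomial (Fin n) G) : G[X] :=
  MvPolynomial.aeval (fun j => C (v j) * X) p

theorem eval_lineRestriction {n : ℕ} (v : Fin n → G) (p : MvPolynomial (Fin n) G) (x : G) :
    (lineRestriction v p).eval x = MvPolynomial.eval (x • v) p := by
  have h : ((aeval x).comp (MvPolynomial.aeval (fun j => C (v j) * X)) :
      MvPolynomial (Fin n) G →ₐ[G] G) = MvPolynomial.aeval (x • v) := by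
    refine MvPolynomial.algHom_ext fun j => ?_
    rw [AlgHom.comp_apply, MvPolynomial.aeval_X, MvPolynomial.aeval_X, map_mul, aeval_C, aeval_X,
      Pi.smul_apply, smul_eq_mul, mul_comm]
    rfl
  have h' := DFunLike.congr_fun h p
  rw [AlgHom.comp_apply, coe_aeval_eq_eval, MvPolynomial.aeval_eq_eval] at h'
  exact h'

/-- A tuple of polynomials over `G`, as a polynomial over the product ring. -/
noncomputable def tuplePolynomial {t : ℕ} (q : Fin t → G[X]) : (Fin t → G)[X] :=
  ∑ i, C (Pi.single i 1) * (q i).map (algebraMap G (Fin t → G))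

theorem eval_tuplePolynomial {t : ℕ} (q : Fin t → G[X]) (x : G) :
    (tuplePolynomial q).eval (algebraMap G (Fin t → G) x) = fun i => (q i).eval x := by
  ext j
  simp only [tuplePolynomial, eval_finsetSum, eval_mul, eval_C, eval_map_algebraMap,
    aeval_algebraMap_apply, Finset.sum_apply, Pi.mul_apply, Pi.single_apply]
  simp

end PolynomialMapping

theorem corollary7p12 {G : Type*} [CommRing G] [IsDomain G] [Infinite G] (n t : ℕ)
    (P : (Fin n → G) → (Fin t → G)) (hP : IsPolynomialMapping P) (hP0 : P 0 = 0)
    (F : Finset (Fin n → G)) (hF : Set.InjOn P (F : Set (Fin n → G)))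
    (r : ℕ) (χ : (Fin t → G) → Fin r) :
    ∃ (h : Fin t → G) (x : G),
      IsMonochromatic χ ((fun v => h + P (x • v)) '' (F : Set (Fin n → G))) ∧
      ((fun v => h + P (x • v)) '' (F : Set (Fin n → G))).ncard = F.card := by
  obtain ⟨p, hp⟩ := hP
  let Q : (Fin n → G) → Fin t → Polynomial G := fun v i => lineRestriction v (p i)
  have hQ : ∀ v x i, (Q v i).eval x = P (x • v) i := fun v x i => by
    rw [hp, eval_lineRestriction]
  -- For `t = 0` the product ring is trivial and has no infinite diagonal, but then `F` has at most
  -- one element.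
  rcases Nat.eq_zero_or_pos t with rfl | ht
  · have hcard : F.card ≤ 1 := Finset.card_le_one.2 fun v hv w hw =>
      hF hv hw (Subsingleton.elim _ _)
    refine ⟨0, 1, ⟨χ 0, fun a _ => congrArg χ (Subsingleton.elim _ _)⟩, ?_⟩
    rw [Set.InjOn.ncard_image, Set.ncard_coe_finset]
    exact fun v hv w hw _ => Finset.card_le_one.1 hcard v hv w hw
  have hinj : Function.Injective (algebraMap G (Fin t → G)) := fun a b h =>
    congrFun h ⟨0, ht⟩
  let S : AddSubgroup (Fin t → G) := (algebraMap G (Fin t → G)).toAddMonoidHom.range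
  have hS : (S : Set (Fin t → G)).Infinite := Set.infinite_range_of_injective hinj
  let bad : Set G := ⋃ v ∈ F, ⋃ w ∈ F, ⋃ i, {x | Q v i - Q w i ≠ 0 ∧ (Q v i - Q w i).IsRoot x}
  have hbad : bad.Finite := by
    refine F.finite_toSet.biUnion fun v _ => F.finite_toSet.biUnion fun w _ =>
      Set.finite_iUnion fun i => ?_
    by_cases h : Q v i - Q w i = 0
    · simp [h]
    · exact (Polynomial.finite_setOfPred_isRoot h).subset fun x hx => hx.2
  have hA0 : ∀ q ∈ (fun v => tuplePolynomial (Q v)) '' (F : Set (Fin n → G)), q.eval 0 = 0 := by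
    rintro _ ⟨v, -, rfl⟩
    rw [← map_zero (algebraMap G (Fin t → G)), eval_tuplePolynomial]
    funext i
    rw [hQ, zero_smul, hP0, map_zero]
  obtain ⟨H, D, -, -, hD, hrec⟩ := isPartitionRecurrent_of_finite hS (F.finite_toSet.image _) hA0
    (algebraMap G (Fin t → G) '' bad) (hbad.image _) r
  obtain ⟨h, -, y, hy, hmono⟩ := hrec χ
  obtain ⟨⟨x, rfl⟩, hx⟩ := hD hy
  have hxbad : x ∉ bad := fun hb => hx ⟨x, hb, rfl⟩
  refine ⟨h, x, ⟨χ h, ?_⟩, ?_⟩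
  · rintro _ ⟨v, hv, rfl⟩
    have heval : (tuplePolynomial (Q v)).eval (algebraMap G (Fin t → G) x) = P (x • v) := by
      rw [eval_tuplePolynomial]
      exact funext fun i => hQ v x i
    change χ (h + P (x • v)) = χ h
    rw [← heval]
    exact hmono _ ⟨v, hv, rfl⟩
  · rw [Set.InjOn.ncard_image, Set.ncard_coe_finset]
    intro v hv w hw hvw
    have hPx : P (x • v) = P (x • w) := add_left_cancel hvw
    refine hF hv hw (funext fun i => ?_)
    by_contra hne
    refine hxbad (Set.mem_biUnion hv (Set.mem_biUnion hw (Set.mem_iUnion.2 ⟨i, ?_, ?_⟩)))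
    -- At `x = 1`, equality of the two polynomials would give `P v i = P w i`.
    · intro hz
      have := congrArg (Polynomial.eval 1) (sub_eq_zero.1 hz)
      rw [hQ, hQ, one_smul, one_smul] at this
      exact hne this
    · rw [Polynomial.IsRoot, Polynomial.eval_sub, hQ, hQ, hPx, sub_self]
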